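/- Let $\mu$ be a $\sigma$-finite measure on a measurable space $\Omega$ and $b:\Omega\to\mathbb{R}^p$ a measurable map. Put $A(\theta)=\log\int_\Omega e^{\theta^T b(x)}\,d\mu(x)$ on the natural parameter space $\mathcal N=\{\theta\in\mathbb{R}^p:\int_\Omega e^{\theta^T b}\,d\mu<\infty\}$, and consider the exponential family of densities $f(x;\theta)=\exp\{\theta^T b(x)-A(\theta)\}$ with respect to $\mu$. Assume that it has full rank: $\mathcal N$ has nonempty interior, and for no $v\ne 0$ in $\mathbb{R}^p$ is $v^T b$ constant $\mu$-almost everywhere. Let $\Theta\subseteq\mathcal N$ be compact, let $\theta_0$ be an interior point of $\Theta$, let $X_1,X_2,\dots$ be i.i.d. with density $f(\cdot;\theta_0)$, and let $q_n>0$ be a sequence with $q_n\to 1$. For $q>0$ let $L_q(u)=\log u$ if $q=1$ and $L_q(u)=(u^{1-q}-1)/(1-q)$ otherwise. The $L_q$-likelihood is $\theta\mapsto\sum_{i=1}^n L_q(f(X_i;\theta))$, and the $L_q$-likelihood equation is $$\sum_{i=1}^n f(X_i;\theta)^{1-q}\,\nabla_\theta\log f(X_i;\theta)=0 ;$$ its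 solutions are the points $\theta$ at which the gradients exist and the equation holds (at boundary points of $\mathcal N$, gradients are taken relative to $\mathcal N$). Then, with probability tending to $1$ as $n\to\infty$, the $L_{q_n}$-likelihood equation for $X_1,\dots,X_n$ has a unique solution $\tilde\theta_n$ in $\Theta$, and $\tilde\theta_n$ is the unique maximizer of the $L_{q_n}$-likelihood over $\Theta$. Moreover $\tilde\theta_n\to\theta_0$ in probability, however $\tilde\theta_n$ is defined on the samples for which the preceding assertion fails. -/

import Mathlib

open MeasureTheory ProbabilityTheory Filter Topology

noncomputable section

namespace LqLikelihood

variable {Ω : Type*} [MeasurableSpace Ω] {p : ℕ}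

/-- The deformed logarithm: `L_q(u) = log u` if `q = 1`, and `(u^(1-q) - 1)/(1-q)` otherwise. -/
def Lq (q u : ℝ) : ℝ :=
  if q = 1 then Real.log u else (u ^ (1 - q) - 1) / (1 - q)

/-- The natural parameter space `{θ : ∫ exp(θᵀ b) dμ < ∞}`. -/
def natParamSpace (μ : Measure Ω) (b : Ω → EuclideanSpace ℝ (Fin p)) :
    Set (EuclideanSpace ℝ (Fin p)) :=
  {θ | Integrable (fun x => Real.exp (inner ℝ θ (b x))) μ}

/-- The log normalizer `A(θ) = log ∫ exp(θᵀ b) dμ`. -/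
def logNormalizer (μ : Measure Ω) (b : Ω → EuclideanSpace ℝ (Fin p))
    (θ : EuclideanSpace ℝ (Fin p)) : ℝ :=
  Real.log (∫ x, Real.exp (inner ℝ θ (b x)) ∂μ)

/-- The density `f(x; θ) = exp(θᵀ b(x) - A(θ))` with respect to `μ`. -/
def density (μ : Measure Ω) (b : Ω → EuclideanSpace ℝ (Fin p))
    (θ : EuclideanSpace ℝ (Fin p)) (x : Ω) : ℝ :=
  Real.exp (inner ℝ θ (b x) - logNormalizer μ b θ)

/-- The distribution with density `f(· ; θ)` with respect to `μ`. -/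
def expFamily (μ : Measure Ω) (b : Ω → EuclideanSpace ℝ (Fin p))
    (θ : EuclideanSpace ℝ (Fin p)) : Measure Ω :=
  μ.withDensity fun x => ENNReal.ofReal (density μ b θ x)

/-- Full rank: the natural parameter space has nonempty interior, and the components of `b`
satisfy no nontrivial affine relation `μ`-almost everywhere. -/
def FullRank (μ : Measure Ω) (b : Ω → EuclideanSpace ℝ (Fin p)) : Prop :=
  (interior (natParamSpace μ b)).Nonempty ∧
    ∀ v : EuclideanSpace ℝ (Fin p), v ≠ 0 → ∀ c : ℝ, ¬ ∀ᵐ x ∂μ, inner ℝ v (b x) = c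

/-- The score `U(x; θ) = ∇_θ log f(x; θ)`. The function `θ ↦ f(x; θ)` lives on the natural
parameter space, so the gradient is taken relative to that set; at its interior points this is
the ordinary gradient. -/
def score (μ : Measure Ω) (b : Ω → EuclideanSpace ℝ (Fin p))
    (θ : EuclideanSpace ℝ (Fin p)) (x : Ω) : EuclideanSpace ℝ (Fin p) :=
  gradientWithin (fun ϑ => Real.log (density μ b ϑ x)) (natParamSpace μ b) θ

/-- The weighted score `U*(x; θ, q) = U(x; θ) f(x; θ)^(1-q)`. -/
def lqScore (μ : Measure Ω) (b : Ω → EuclideanSpace ℝ (Fin p)) (q : ℝ)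
    (θ : EuclideanSpace ℝ (Fin p)) (x : Ω) : EuclideanSpace ℝ (Fin p) :=
  (density μ b θ x) ^ (1 - q) • score μ b θ x

/-- The `Lq`-likelihood `∑ i, L_q(f(x_i; θ))` of a sample `x_1, …, x_n`. -/
def lqLikelihood (μ : Measure Ω) (b : Ω → EuclideanSpace ℝ (Fin p)) (q : ℝ) {n : ℕ}
    (x : Fin n → Ω) (θ : EuclideanSpace ℝ (Fin p)) : ℝ :=
  ∑ i, Lq q (density μ b θ (x i))

/-- The solutions in `Θ` of the `Lq`-likelihood equation `∑ i, U*(x_i; θ, q) = 0`. A solution is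
a point at which the scores exist (automatic in the interior of the natural parameter space). -/
def lqSolutions (μ : Measure Ω) (b : Ω → EuclideanSpace ℝ (Fin p))
    (Θ : Set (EuclideanSpace ℝ (Fin p))) (q : ℝ) {n : ℕ} (x : Fin n → Ω) :
    Set (EuclideanSpace ℝ (Fin p)) :=
  {θ ∈ Θ | (∀ i, DifferentiableWithinAt ℝ (fun ϑ => Real.log (density μ b ϑ (x i)))
      (natParamSpace μ b) θ) ∧ ∑ i, lqScore μ b q θ (x i) = 0}

/-- The maximizers over `Θ` of the `Lq`-likelihood. -/
def lqMaximizers (μ : Measure Ω) (b : Ω → EuclideanSpace ℝ (Fin p))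
    (Θ : Set (EuclideanSpace ℝ (Fin p))) (q : ℝ) {n : ℕ} (x : Fin n → Ω) :
    Set (EuclideanSpace ℝ (Fin p)) :=
  {θ ∈ Θ | IsMaxOn (lqLikelihood μ b q x) Θ θ}

/-- `t` is the only solution in `Θ` of the `Lq`-likelihood equation, and it is the (only)
maximizer of the `Lq`-likelihood over `Θ`. -/
def IsUniqueMLqE (μ : Measure Ω) (b : Ω → EuclideanSpace ℝ (Fin p))
    (Θ : Set (EuclideanSpace ℝ (Fin p))) (q : ℝ) {n : ℕ} (x : Fin n → Ω)
    (t : EuclideanSpace ℝ (Fin p)) : Prop :=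
  lqSolutions μ b Θ q x = {t} ∧ lqMaximizers μ b Θ q x = {t}

end LqLikelihood

end

noncomputable section

namespace LqLikelihood

variable {Ω : Type*} [MeasurableSpace Ω] {p : ℕ}

/-! ### The exponential family: convexity and gradient of the log normalizer. -/

section Family

variable {μ : Measure Ω} {b : Ω → EuclideanSpace ℝ (Fin p)} {θ θ' : EuclideanSpace ℝ (Fin p)}

/-! Put `ε = 1 - q`. Since `f ^ ε = exp (ε (θᵀ b - A θ))`, the likelihood is a strictly increasing
function of `G θ - A θ`, where `G = ε⁻¹ log ∑ exp (ε θᵀ b(x_i))`, read as the sample mean of `θᵀ b`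
when `ε = 0` (`exists_strictMono_lqLikelihood_eq`). The likelihood equation says that `∇G`, a mean
of the `b(x_i)` with tilted weights, is the gradient of `A` (`mem_lqSolutions_iff`). The problem
thus compares a random `G` that is nearly linear with a fixed convex `A`.

As `ε → 0` the tilted mean has Lipschitz constant `O(|ε|)` on bounded sets, provided one empirical
exponential moment is bounded (`norm_tiltMean_sub_le`). It is therefore uniformly close to the
sample mean, hence to `∇A(θ₀)`. The weak law is needed only for `b` and for that moment, both under
`θ₀`.

Full rank makes `∇A` strongly monotone near `θ₀` (`exists_strongMono_meanParam`), and convexity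
turns this into linear growth of `A` above its tangent plane at `θ₀` on all of the natural parameter
space (`linear_growth_of_strongMono`). So neither a solution nor a maximizer can lie far from `θ₀`,
even on the boundary. Near `θ₀`, strong monotonicity beats the small Lipschitz constant and leaves
at most one solution, and a maximizer over a small ball supplies one. `exists_isUniqueMLqE` is this
deterministic argument. -/

lemma density_pos (θ : EuclideanSpace ℝ (Fin p)) (x : Ω) : 0 < density μ b θ x := Real.exp_pos _

lemma log_density (θ : EuclideanSpace ℝ (Fin p)) (x : Ω) :
    Real.log (density μ b θ x) = inner ℝ θ (b x) - logNormalizer μ b θ := Real.log_exp _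

lemma density_eq_mul (θ : EuclideanSpace ℝ (Fin p)) (x : Ω) :
    density μ b θ x = Real.exp (-logNormalizer μ b θ) * Real.exp (inner ℝ θ (b x)) := by
  rw [density, ← Real.exp_add]; ring_nf

lemma measurable_density (hb : Measurable b) (θ : EuclideanSpace ℝ (Fin p)) :
    Measurable (density μ b θ) := by
  unfold density; fun_prop

lemma integrable_density (hθ : θ ∈ natParamSpace μ b) : Integrable (density μ b θ) μ :=
  (hθ.const_mul (Real.exp (-logNormalizer μ b θ))).congr
    (.of_forall fun x => (density_eq_mul θ x).symm)

lemma exp_logNormalizer [NeZero μ] (hθ : θ ∈ natParamSpace μ b) :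
    Real.exp (logNormalizer μ b θ) = ∫ x, Real.exp (inner ℝ θ (b x)) ∂μ :=
  Real.exp_log (integral_exp_pos hθ)

lemma integral_density [NeZero μ] (hθ : θ ∈ natParamSpace μ b) :
    ∫ x, density μ b θ x ∂μ = 1 := by
  simp_rw [density_eq_mul, integral_const_mul, ← exp_logNormalizer hθ, ← Real.exp_add]
  simp

/-- Convexity of `exp` applied to the two log densities. Normalizing first makes its integral yield
Hölder's inequality with the right constant. -/
lemma exp_inner_convexComb_le (x : Ω) {s t : ℝ} (hs : 0 ≤ s) (ht : 0 ≤ t) (hst : s + t = 1) :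
    Real.exp (inner ℝ (s • θ + t • θ') (b x)) ≤
      Real.exp (s * logNormalizer μ b θ + t * logNormalizer μ b θ') *
        (s * density μ b θ x + t * density μ b θ' x) := by
  have h := convexOn_exp.2 (Set.mem_univ (inner ℝ θ (b x) - logNormalizer μ b θ))
    (Set.mem_univ (inner ℝ θ' (b x) - logNormalizer μ b θ')) hs ht hst
  simp only [smul_eq_mul] at h
  refine le_trans (le_of_eq ?_) (mul_le_mul_of_nonneg_left h (Real.exp_pos _).le)
  rw [← Real.exp_add, inner_add_left, real_inner_smul_left, real_inner_smul_left]
  ring_nf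

lemma convexOn_logNormalizer [NeZero μ] (hb : Measurable b) :
    ConvexOn ℝ (natParamSpace μ b) (logNormalizer μ b) := by
  have key : ∀ θ ∈ natParamSpace μ b, ∀ θ' ∈ natParamSpace μ b, ∀ s t : ℝ, 0 ≤ s → 0 ≤ t →
      s + t = 1 → s • θ + t • θ' ∈ natParamSpace μ b ∧
      ∫ x, Real.exp (inner ℝ (s • θ + t • θ') (b x)) ∂μ ≤
        Real.exp (s * logNormalizer μ b θ + t * logNormalizer μ b θ') := by
    intro θ hθ θ' hθ' s t hs ht hst
    have hi : Integrable (fun x => Real.exp (s * logNormalizer μ b θ + t * logNormalizer μ b θ') *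
        (s * density μ b θ x + t * density μ b θ' x)) μ :=
      (((integrable_density hθ).const_mul s).add ((integrable_density hθ').const_mul t)).const_mul _
    have hmem : s • θ + t • θ' ∈ natParamSpace μ b := by
      refine hi.mono' (by fun_prop) (.of_forall fun x => ?_)
      rw [Real.norm_of_nonneg (Real.exp_pos _).le]
      exact exp_inner_convexComb_le x hs ht hst
    refine ⟨hmem, (integral_mono hmem hi fun x => exp_inner_convexComb_le x hs ht hst).trans ?_⟩
    rw [integral_const_mul, integral_add ((integrable_density hθ).const_mul s)
      ((integrable_density hθ').const_mul t), integral_const_mul, integral_const_mul,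
      integral_density hθ, integral_density hθ']
    simp [hst]
  refine ⟨fun θ hθ θ' hθ' s t hs ht hst => (key θ hθ θ' hθ' s t hs ht hst).1,
    fun θ hθ θ' hθ' s t hs ht hst => ?_⟩
  obtain ⟨hm, hle⟩ := key θ hθ θ' hθ' s t hs ht hst
  rw [← exp_logNormalizer hm, Real.exp_le_exp] at hle
  simpa using hle

lemma exp_mul_norm_le {r : ℝ} (hr : 0 ≤ r) (y : EuclideanSpace ℝ (Fin p)) :
    Real.exp (r * ‖y‖) ≤ 1 + ∑ j, (Real.exp (r * p * y j) + Real.exp (-(r * p * y j))) := by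
  rcases isEmpty_or_nonempty (Fin p) with h | h
  · have : y = 0 := by ext j; exact h.elim j
    simp [this]
  obtain ⟨j, -, hj⟩ := Finset.exists_max_image Finset.univ (fun j => |y j|) Finset.univ_nonempty
  have hy : ‖y‖ ≤ p * |y j| := by
    calc ‖y‖ = ‖∑ i, EuclideanSpace.single i (y i)‖ := by
            congr 1; ext i; simp [Finset.sum_apply, Pi.single_apply]
      _ ≤ ∑ i, ‖EuclideanSpace.single i (y i)‖ := norm_sum_le _ _
      _ ≤ ∑ _i : Fin p, |y j| := Finset.sum_le_sum fun i hi => by simpa using hj i hi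
      _ = p * |y j| := by simp
  have h1 : Real.exp (r * ‖y‖) ≤ Real.exp (r * p * y j) + Real.exp (-(r * p * y j)) := by
    have hle : r * ‖y‖ ≤ |r * p * y j| := by
      rw [abs_mul, abs_of_nonneg (by positivity), mul_assoc]
      exact mul_le_mul_of_nonneg_left hy hr
    refine (Real.exp_le_exp.2 hle).trans ?_
    rcases abs_cases (r * p * y j) with ⟨h, -⟩ | ⟨h, -⟩ <;> rw [h] <;>
      linarith [Real.exp_pos (r * p * y j), Real.exp_pos (-(r * p * y j))]
  have h2 := Finset.single_le_sum (f := fun j => Real.exp (r * p * y j) + Real.exp (-(r * p * y j)))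
    (fun i _ => by positivity) (Finset.mem_univ j)
  linarith

/-- Moving `θ` a little along each coordinate axis stays in the natural parameter space, and these
finitely many exponentials dominate `exp (r ‖b‖)`. -/
lemma exists_integrable_exp_norm (hb : Measurable b) (hθ : θ ∈ interior (natParamSpace μ b)) :
    ∃ r > 0, Integrable (fun x => Real.exp (inner ℝ θ (b x)) * Real.exp (r * ‖b x‖)) μ := by
  obtain ⟨ρ, hρ, hsub⟩ := Metric.isOpen_iff.1 isOpen_interior θ hθ
  -- Small enough that the shifts by `± r p` along the axes stay in the ball of radius `ρ`.
  set r : ℝ := ρ / (2 * (p + 1)) with hr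
  have hr0 : 0 < r := by positivity
  have hrp : r * p < ρ := by
    rw [hr, div_mul_eq_mul_div, div_lt_iff₀ (by positivity)]
    nlinarith [(Nat.cast_nonneg p : (0 : ℝ) ≤ p)]
  have hmem : ∀ j (σ : ℝ), |σ| = 1 →
      θ + EuclideanSpace.single j (σ * (r * p)) ∈ natParamSpace μ b := by
    intro j σ hσ
    refine interior_subset (hsub ?_)
    rw [Metric.mem_ball, dist_eq_norm, add_sub_cancel_left, PiLp.norm_single,
      Real.norm_eq_abs, abs_mul, hσ, one_mul, abs_of_nonneg (by positivity)]
    exact hrp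
  refine ⟨r, hr0, ?_⟩
  have hθN : Integrable (fun x => Real.exp (inner ℝ θ (b x))) μ :=
    interior_subset (s := natParamSpace μ b) hθ
  have hsum : Integrable (fun x => Real.exp (inner ℝ θ (b x)) + ∑ j,
      (Real.exp (inner ℝ (θ + EuclideanSpace.single j (1 * (r * p))) (b x)) +
        Real.exp (inner ℝ (θ + EuclideanSpace.single j (-1 * (r * p))) (b x)))) μ :=
    hθN.add (integrable_finsetSum _ fun j _ =>
      (hmem j 1 (by simp)).add (hmem j (-1) (by simp)))
  refine hsum.mono' (by fun_prop) (.of_forall fun x => ?_)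
  rw [Real.norm_of_nonneg (by positivity)]
  refine (mul_le_mul_of_nonneg_left (exp_mul_norm_le hr0.le (b x)) (Real.exp_pos _).le).trans
    (le_of_eq ?_)
  rw [mul_add, mul_one, Finset.mul_sum]
  congr 1
  refine Finset.sum_congr rfl fun j _ => ?_
  rw [mul_add, ← Real.exp_add, ← Real.exp_add]
  simp [inner_add_left, EuclideanSpace.inner_single_left]

/-- A weight that dominates `b`, its square, and its small exponential moments. -/
def expWeight (r : ℝ) (y : EuclideanSpace ℝ (Fin p)) : ℝ := (1 + ‖y‖) ^ 2 * Real.exp (r * ‖y‖)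

lemma sq_one_add_norm_le_expWeight {r : ℝ} (hr : 0 ≤ r) (y : EuclideanSpace ℝ (Fin p)) :
    (1 + ‖y‖) ^ 2 ≤ expWeight r y :=
  le_mul_of_one_le_right (by positivity) (Real.one_le_exp (by positivity))

lemma measurable_expWeight (r : ℝ) : Measurable (expWeight (p := p) r) := by
  unfold expWeight; fun_prop

lemma expWeight_nonneg (r : ℝ) (y : EuclideanSpace ℝ (Fin p)) : 0 ≤ expWeight r y := by
  unfold expWeight; positivity

lemma exists_integrable_expWeight (hb : Measurable b) (hθ : θ ∈ interior (natParamSpace μ b)) :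
    ∃ r > 0, Integrable (fun x => density μ b θ x * expWeight r (b x)) μ := by
  obtain ⟨r, hr, hi⟩ := exists_integrable_exp_norm hb hθ
  -- One third of the exponent is kept; the other two absorb the two factors `1 + ‖b x‖`.
  refine ⟨r / 3, by positivity, ?_⟩
  refine (hi.const_mul (Real.exp (-logNormalizer μ b θ) * (1 + 3 / r) ^ 2)).mono'
    (((measurable_density hb θ).mul ((measurable_expWeight _).comp hb)).aestronglyMeasurable)
    (.of_forall fun x => ?_)
  rw [Real.norm_of_nonneg (mul_nonneg (density_pos θ x).le (expWeight_nonneg _ _)), density_eq_mul,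
    mul_assoc, mul_assoc, mul_left_comm ((1 + 3 / r) ^ 2)]
  refine mul_le_mul_of_nonneg_left (mul_le_mul_of_nonneg_left ?_ (Real.exp_pos _).le)
    (Real.exp_pos _).le
  set e := Real.exp (r / 3 * ‖b x‖) with he
  have h1 : 1 + ‖b x‖ ≤ (1 + 3 / r) * e := by
    have h2 : r / 3 * ‖b x‖ + 1 ≤ e := Real.add_one_le_exp _
    have h3 : 1 ≤ e := Real.one_le_exp (by positivity)
    have h4 : ‖b x‖ = 3 / r * (r / 3 * ‖b x‖) := by field_simp
    have h5 : 3 / r * (r / 3 * ‖b x‖) ≤ 3 / r * e :=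
      mul_le_mul_of_nonneg_left (by linarith) (by positivity)
    linarith
  have h6 : Real.exp (r * ‖b x‖) = e ^ 2 * e := by
    rw [he, ← pow_succ, ← Real.exp_nat_mul]; congr 1; push_cast; ring
  rw [expWeight, h6, ← mul_assoc, ← mul_pow]
  gcongr

/-- The mean of `b` under the member `θ` of the family. -/
def meanParam (μ : Measure Ω) (b : Ω → EuclideanSpace ℝ (Fin p))
    (θ : EuclideanSpace ℝ (Fin p)) : EuclideanSpace ℝ (Fin p) :=
  ∫ x, density μ b θ x • b x ∂μ

lemma integrable_density_smul (hb : Measurable b) (hθ : θ ∈ interior (natParamSpace μ b)) :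
    Integrable (fun x => density μ b θ x • b x) μ := by
  obtain ⟨r, hr, hi⟩ := exists_integrable_expWeight hb hθ
  refine hi.mono' ((measurable_density hb θ).smul hb).aestronglyMeasurable (.of_forall fun x => ?_)
  rw [norm_smul, Real.norm_of_nonneg (density_pos θ x).le]
  refine mul_le_mul_of_nonneg_left ?_ (density_pos θ x).le
  nlinarith [sq_one_add_norm_le_expWeight hr.le (b x), norm_nonneg (b x)]

lemma hasFDerivAt_inner_left (y θ : EuclideanSpace ℝ (Fin p)) :
    HasFDerivAt (fun ϑ => inner ℝ ϑ y) (innerSL ℝ y) θ :=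
  ((innerSL ℝ y).hasFDerivAt (x := θ)).congr_of_eventuallyEq
    (.of_forall fun ϑ => by simp [real_inner_comm])

lemma hasGradientAt_integral_exp (hb : Measurable b) (hθ : θ ∈ interior (natParamSpace μ b)) :
    HasGradientAt (fun ϑ => ∫ x, Real.exp (inner ℝ ϑ (b x)) ∂μ)
      (∫ x, Real.exp (inner ℝ θ (b x)) • b x ∂μ) θ := by
  obtain ⟨r, hr, hi⟩ := exists_integrable_expWeight hb hθ
  have hmeas : Measurable fun x => Real.exp (inner ℝ θ (b x)) • b x := by fun_prop
  -- The radius of the ball equals the exponential slack `r`, so one function dominates the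
  -- derivatives at all `ϑ` in it.
  have hbd : ∀ x, ∀ ϑ ∈ Metric.ball θ r, Real.exp (inner ℝ ϑ (b x)) * ‖b x‖ ≤
      Real.exp (logNormalizer μ b θ) * (density μ b θ x * expWeight r (b x)) := by
    intro x ϑ hϑ
    have h1 : inner ℝ ϑ (b x) ≤ inner ℝ θ (b x) + r * ‖b x‖ := by
      have h2 := real_inner_le_norm (ϑ - θ) (b x)
      rw [inner_sub_left] at h2
      have h3 : ‖ϑ - θ‖ * ‖b x‖ ≤ r * ‖b x‖ :=
        mul_le_mul_of_nonneg_right (by simpa [dist_eq_norm] using (Metric.mem_ball.1 hϑ).le)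
          (norm_nonneg _)
      linarith
    have h4 : Real.exp (logNormalizer μ b θ) * (density μ b θ x * expWeight r (b x)) =
        Real.exp (inner ℝ θ (b x) + r * ‖b x‖) * (1 + ‖b x‖) ^ 2 := by
      rw [expWeight, ← mul_assoc, density, ← Real.exp_add, Real.exp_add _ (r * ‖b x‖)]; ring_nf
    rw [h4]
    refine mul_le_mul (Real.exp_le_exp.2 h1) ?_ (norm_nonneg _) (Real.exp_pos _).le
    nlinarith [norm_nonneg (b x)]
  have hint : Integrable (fun x => Real.exp (inner ℝ θ (b x)) • b x) μ := by
    refine (hi.const_mul (Real.exp (logNormalizer μ b θ))).mono' hmeas.aestronglyMeasurable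
      (.of_forall fun x => ?_)
    rw [norm_smul, Real.norm_of_nonneg (Real.exp_pos _).le]
    exact hbd x θ (Metric.mem_ball_self hr)
  have hdual : (InnerProductSpace.toDual ℝ (EuclideanSpace ℝ (Fin p)))
        (∫ x, Real.exp (inner ℝ θ (b x)) • b x ∂μ) =
      ∫ x, Real.exp (inner ℝ θ (b x)) • innerSL ℝ (b x) ∂μ := by
    have := (innerSL ℝ (E := EuclideanSpace ℝ (Fin p))).integral_comp_comm hint
    simp only [map_smul] at this
    rw [this]; rfl
  rw [hasGradientAt_iff_hasFDerivAt, hdual]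
  refine hasFDerivAt_integral_of_dominated_of_fderiv_le
    (F' := fun ϑ x => Real.exp (inner ℝ ϑ (b x)) • innerSL ℝ (b x))
    (Metric.ball_mem_nhds θ hr) (.of_forall fun ϑ => by fun_prop)
    (interior_subset (s := natParamSpace μ b) hθ) ?_
    (.of_forall fun x ϑ hϑ => ?_) (hi.const_mul (Real.exp (logNormalizer μ b θ)))
    (.of_forall fun x ϑ hϑ => ?_)
  · have := ((innerSL ℝ (E := EuclideanSpace ℝ (Fin p))).continuous.measurable.comp
      hmeas).aestronglyMeasurable (μ := μ)
    simpa [Function.comp_def] using this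
  · rw [norm_smul, Real.norm_of_nonneg (Real.exp_pos _).le, innerSL_apply_norm]
    exact hbd x ϑ hϑ
  · exact (hasFDerivAt_inner_left (b x) ϑ).exp

lemma hasGradientAt_logNormalizer [NeZero μ] (hb : Measurable b)
    (hθ : θ ∈ interior (natParamSpace μ b)) :
    HasGradientAt (logNormalizer μ b) (meanParam μ b θ) θ := by
  have hθN : θ ∈ natParamSpace μ b := interior_subset hθ
  have h := (hasGradientAt_integral_exp hb hθ).hasFDerivAt.log (integral_exp_pos hθN).ne'
  have e : meanParam μ b θ = (∫ x, Real.exp (inner ℝ θ (b x)) ∂μ)⁻¹ •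
      ∫ x, Real.exp (inner ℝ θ (b x)) • b x ∂μ := by
    rw [← exp_logNormalizer hθN, ← Real.exp_neg, meanParam, ← integral_smul]
    simp_rw [density_eq_mul, mul_smul]
  rw [hasGradientAt_iff_hasFDerivAt, e, map_smul]
  exact h

end Family

/-! ### Strong monotonicity of the mean map and linear growth of the log normalizer. -/

section Convexity

/-- Chord slopes towards `y` are at most `f y - f x`, and they tend to the directional derivative. A
relative gradient suffices, so boundary points are covered. -/
lemma _root_.ConvexOn.add_inner_gradientWithin_le {F : Type*} [NormedAddCommGroup F]
    [InnerProductSpace ℝ F] [CompleteSpace F] {s : Set F} {f : F → ℝ} {g x y : F}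
    (hf : ConvexOn ℝ s f) (hg : HasGradientWithinAt f g s x) (hx : x ∈ s) (hy : y ∈ s) :
    f x + inner ℝ g (y - x) ≤ f y := by
  have hline : HasDerivWithinAt (fun t : ℝ => x + t • (y - x)) (y - x) (Set.Ioc 0 1) 0 := by
    simpa using (((hasDerivAt_id (0 : ℝ)).smul_const (y - x)).const_add x).hasDerivWithinAt
  have hmaps : Set.MapsTo (fun t : ℝ => x + t • (y - x)) (Set.Ioc 0 1) s := fun t ht =>
    hf.1.add_smul_sub_mem hx hy ⟨ht.1.le, ht.2⟩
  have hd : HasDerivWithinAt (fun t : ℝ => f (x + t • (y - x))) (inner ℝ g (y - x))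
      (Set.Ioc 0 1) 0 := by
    have h0 : HasFDerivWithinAt f (innerSL ℝ g) s (x + (0 : ℝ) • (y - x)) := by
      rw [zero_smul, add_zero]; exact hg.hasFDerivWithinAt
    exact h0.comp_hasDerivWithinAt (0 : ℝ) hline hmaps
  rw [hasDerivWithinAt_iff_tendsto_slope' (by simp)] at hd
  have : (𝓝[Set.Ioc (0 : ℝ) 1] 0).NeBot := by
    rw [nhdsWithin_Ioc_eq_nhdsGT one_pos]; infer_instance
  have hle : inner ℝ g (y - x) ≤ f y - f x := by
    refine le_of_tendsto hd (eventually_nhdsWithin_of_forall fun t ht => ?_)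
    have hc := hf.2 hx hy (sub_nonneg.2 ht.2) ht.1.le (by ring)
    have e : (1 - t) • x + t • y = x + t • (y - x) := by module
    rw [e, smul_eq_mul, smul_eq_mul] at hc
    rw [slope_def_field, div_le_iff₀ (by linarith [ht.1])]
    simp only [zero_smul, add_zero, sub_zero]
    linarith
  linarith

lemma mul_sq_le_exp_sub_mul_sub {l s t : ℝ} (hs : l ≤ Real.exp s) (ht : l ≤ Real.exp t) :
    l * (s - t) ^ 2 ≤ (Real.exp s - Real.exp t) * (s - t) := by
  wlog h : t ≤ s generalizing s t
  · have := this ht hs (le_of_not_ge h)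
    linarith
  have h1 : Real.exp t * (s - t) ≤ Real.exp s - Real.exp t := by
    have h2 := Real.add_one_le_exp (s - t)
    have h3 : Real.exp s = Real.exp t * Real.exp (s - t) := by rw [← Real.exp_add]; ring_nf
    rw [h3]
    nlinarith [Real.exp_pos t]
  have h4 : 0 ≤ s - t := sub_nonneg.2 h
  have h5 : l * (s - t) ≤ Real.exp t * (s - t) := mul_le_mul_of_nonneg_right ht h4
  nlinarith

variable {μ : Measure Ω} {b : Ω → EuclideanSpace ℝ (Fin p)} {θ₀ : EuclideanSpace ℝ (Fin p)}

lemma sq_inner_sub_le (y v : EuclideanSpace ℝ (Fin p)) (a : ℝ) {C : ℝ}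
    (hv : ‖v‖ ≤ C) (ha : |a| ≤ C) :
    (inner ℝ v (y) - a) ^ 2 ≤ C ^ 2 * (1 + ‖y‖) ^ 2 := by
  have h1 : |inner ℝ v (y) - a| ≤ C * (1 + ‖y‖) := by
    refine (abs_sub _ _).trans ?_
    have := abs_real_inner_le_norm v (y)
    have : ‖v‖ * ‖y‖ ≤ C * ‖y‖ := mul_le_mul_of_nonneg_right hv (norm_nonneg _)
    linarith
  rw [← mul_pow, ← sq_abs]
  gcongr

lemma integrable_mul_sq_inner_sub (hb : Measurable b) {ω : Ω → ℝ} (hωm : Measurable ω)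
    (hω : ∀ x, 0 < ω x) (hi : Integrable (fun x => ω x * (1 + ‖b x‖) ^ 2) μ)
    (v : EuclideanSpace ℝ (Fin p)) (a : ℝ) :
    Integrable (fun x => ω x * (inner ℝ v (b x) - a) ^ 2) μ := by
  refine (hi.const_mul (max ‖v‖ |a| ^ 2)).mono' (by fun_prop) (.of_forall fun x => ?_)
  rw [Real.norm_of_nonneg (mul_nonneg (hω x).le (sq_nonneg _)), mul_left_comm]
  exact mul_le_mul_of_nonneg_left (sq_inner_sub_le (b x) v a (le_max_left _ _) (le_max_right _ _))
    (hω x).le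

/-- Under full rank, the weighted variance of `vᵀ b` is a positive definite form in `v`. -/
lemma FullRank.exists_mul_sq_norm_le [NeZero μ] (hrank : FullRank μ b) (hb : Measurable b)
    {ω : Ω → ℝ} (hωm : Measurable ω) (hω : ∀ x, 0 < ω x)
    (hi : Integrable (fun x => ω x * (1 + ‖b x‖) ^ 2) μ) :
    ∃ c > 0, ∀ (v : EuclideanSpace ℝ (Fin p)) (a : ℝ),
      c * ‖v‖ ^ 2 ≤ ∫ x, ω x * (inner ℝ v (b x) - a) ^ 2 ∂μ := by
  -- The centring constant is a second variable: positivity on the compact unit sphere of pairs `(v,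
  -- a)` then gives a bound uniform in `a`.
  set Q : EuclideanSpace ℝ (Fin p) × ℝ → ℝ :=
    fun w => ∫ x, ω x * (inner ℝ w.1 (b x) - w.2) ^ 2 ∂μ with hQ
  have hcont : ContinuousOn Q (Metric.sphere 0 1) := by
    refine continuousOn_of_dominated (bound := fun x => ω x * (1 + ‖b x‖) ^ 2)
      (fun w _ => by fun_prop) (fun w hw => .of_forall fun x => ?_) hi
      (.of_forall fun x => by fun_prop)
    rw [Real.norm_of_nonneg (mul_nonneg (hω x).le (sq_nonneg _))]
    refine mul_le_mul_of_nonneg_left ?_ (hω x).le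
    have hw1 : ‖w‖ = 1 := by simpa using hw
    simpa using sq_inner_sub_le (b x) w.1 w.2 (C := 1) (hw1 ▸ norm_fst_le w) (hw1 ▸ norm_snd_le w)
  have hpos : ∀ w ∈ Metric.sphere (0 : EuclideanSpace ℝ (Fin p) × ℝ) 1, 0 < Q w := by
    intro w hw
    have hw1 : ‖w‖ = 1 := by simpa using hw
    have hnn : 0 ≤ fun x => ω x * (inner ℝ w.1 (b x) - w.2) ^ 2 :=
      fun x => mul_nonneg (hω x).le (sq_nonneg _)
    refine (integral_nonneg hnn).lt_of_ne fun h0 => ?_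
    have hae := (integral_eq_zero_iff_of_nonneg hnn
      (integrable_mul_sq_inner_sub hb hωm hω hi w.1 w.2)).1 h0.symm
    have hae' : ∀ᵐ x ∂μ, inner ℝ w.1 (b x) = w.2 := by
      filter_upwards [hae] with x hx
      have hx' : ω x * (inner ℝ w.1 (b x) - w.2) ^ 2 = 0 := hx
      rcases mul_eq_zero.1 hx' with h | h
      · exact absurd h (hω x).ne'
      · exact sub_eq_zero.1 (pow_eq_zero_iff two_ne_zero |>.1 h)
    by_cases hv : w.1 = 0
    · obtain ⟨x, hx⟩ := hae'.exists
      have h2 : w.2 = 0 := by rw [← hx, hv, inner_zero_left]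
      have : w = 0 := Prod.ext hv h2
      simp [this] at hw1
    · exact hrank.2 w.1 hv w.2 hae'
  obtain ⟨c, hc, hcK⟩ := (isCompact_sphere (0 : EuclideanSpace ℝ (Fin p) × ℝ) 1).exists_forall_le'
    hcont hpos
  refine ⟨c, hc, fun v a => ?_⟩
  by_cases hw : ((v, a) : EuclideanSpace ℝ (Fin p) × ℝ) = 0
  · obtain ⟨rfl, rfl⟩ := Prod.mk_eq_zero.1 hw
    simp
  set N := ‖((v, a) : EuclideanSpace ℝ (Fin p) × ℝ)‖ with hN
  have hN0 : 0 < N := norm_pos_iff.2 hw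
  have h1 := hcK (N⁻¹ • (v, a)) (by
    rw [mem_sphere_zero_iff_norm, norm_smul, norm_inv, Real.norm_of_nonneg hN0.le, ← hN,
      inv_mul_cancel₀ hN0.ne'])
  have h2 : Q (N⁻¹ • (v, a)) = N⁻¹ ^ 2 * ∫ x, ω x * (inner ℝ v (b x) - a) ^ 2 ∂μ := by
    rw [hQ, ← integral_const_mul]
    refine integral_congr_ae (.of_forall fun x => ?_)
    simp only [Prod.smul_mk, real_inner_smul_left, smul_eq_mul]
    ring
  rw [h2, inv_pow, ← div_eq_inv_mul, le_div_iff₀ (by positivity)] at h1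
  refine le_trans ?_ h1
  have : ‖v‖ ≤ N := norm_fst_le ((v, a) : EuclideanSpace ℝ (Fin p) × ℝ)
  gcongr

/-- The inner product is the symmetrized divergence `∫ (f_θ - f_θ') (log f_θ - log f_θ') dμ`. Where
both densities exceed `ω`, its integrand is at least `ω (log f_θ - log f_θ')²`, and full rank bounds
the integral of that below. -/
lemma exists_strongMono_meanParam [NeZero μ] (hrank : FullRank μ b) (hb : Measurable b)
    (hθ₀ : θ₀ ∈ interior (natParamSpace μ b)) :
    ∃ δ > 0, ∃ c > 0, Metric.ball θ₀ δ ⊆ interior (natParamSpace μ b) ∧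
      ∀ θ ∈ Metric.ball θ₀ δ, ∀ θ' ∈ Metric.ball θ₀ δ,
        c * ‖θ - θ'‖ ^ 2 ≤ inner ℝ (meanParam μ b θ - meanParam μ b θ') (θ - θ') := by
  have hcA : ∀ᶠ θ in 𝓝 θ₀, logNormalizer μ b θ < logNormalizer μ b θ₀ + 1 :=
    (hasGradientAt_logNormalizer hb hθ₀).differentiableAt.continuousAt.eventually
      (gt_mem_nhds (by linarith))
  obtain ⟨δ, hδ, hsub⟩ := Metric.mem_nhds_iff.1 (hcA.and (isOpen_interior.mem_nhds hθ₀))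
  -- A common lower bound for the densities over the ball: `A` rises by at most `1` there, and `θᵀ
  -- b` drops by at most `δ ‖b‖`.
  set ω : Ω → ℝ := fun x => density μ b θ₀ x * Real.exp (-(δ * ‖b x‖) - 1) with hωdef
  have hωm : Measurable ω := (measurable_density hb θ₀).mul (by fun_prop)
  have hω : ∀ x, 0 < ω x := fun x => mul_pos (density_pos _ _) (Real.exp_pos _)
  have hi : Integrable (fun x => ω x * (1 + ‖b x‖) ^ 2) μ := by
    obtain ⟨r, hr, hint⟩ := exists_integrable_expWeight hb hθ₀
    refine hint.mono' (by fun_prop) (.of_forall fun x => ?_)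
    rw [Real.norm_of_nonneg (mul_nonneg (hω x).le (sq_nonneg _)), hωdef, mul_assoc]
    refine mul_le_mul_of_nonneg_left ?_ (density_pos _ _).le
    refine le_trans (mul_le_of_le_one_left (sq_nonneg _) ?_) (sq_one_add_norm_le_expWeight hr.le _)
    rw [Real.exp_le_one_iff]
    have := mul_nonneg hδ.le (norm_nonneg (b x))
    linarith
  obtain ⟨c, hc, hQ⟩ := hrank.exists_mul_sq_norm_le hb hωm hω hi
  refine ⟨δ, hδ, c, hc, fun θ hθ => (hsub hθ).2, fun θ hθ θ' hθ' => ?_⟩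
  have hlow : ∀ θ ∈ Metric.ball θ₀ δ, ∀ x, ω x ≤ density μ b θ x := by
    intro θ hθ x
    simp only [hωdef, density]
    rw [← Real.exp_add, Real.exp_le_exp]
    have h1 : logNormalizer μ b θ < logNormalizer μ b θ₀ + 1 := (hsub hθ).1
    have h2 := real_inner_le_norm (θ₀ - θ) (b x)
    rw [inner_sub_left] at h2
    have h3 : ‖θ₀ - θ‖ * ‖b x‖ ≤ δ * ‖b x‖ := by
      refine mul_le_mul_of_nonneg_right ?_ (norm_nonneg _)
      rw [← dist_eq_norm, dist_comm]; exact (Metric.mem_ball.1 hθ).le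
    linarith
  set a := logNormalizer μ b θ - logNormalizer μ b θ' with ha
  have hθi := (hsub hθ).2
  have hθi' := (hsub hθ').2
  have hd := integrable_density (interior_subset hθi)
  have hd' := integrable_density (interior_subset hθi')
  have hsm := integrable_density_smul hb hθi
  have hsm' := integrable_density_smul hb hθi'
  have hI1 : Integrable (fun x => inner ℝ (θ - θ') (density μ b θ x • b x)
      - inner ℝ (θ - θ') (density μ b θ' x • b x)) μ :=
    (hsm.const_inner _).sub (hsm'.const_inner _)
  have hI2 : Integrable (fun x => a * (density μ b θ x - density μ b θ' x)) μ :=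
    (hd.sub hd').const_mul a
  -- Subtracting the multiple of `a` changes nothing, since both densities have integral `1`.
  have heq : inner ℝ (meanParam μ b θ - meanParam μ b θ') (θ - θ') =
      ∫ x, (inner ℝ (θ - θ') (density μ b θ x • b x) - inner ℝ (θ - θ') (density μ b θ' x • b x))
        - a * (density μ b θ x - density μ b θ' x) ∂μ := by
    rw [integral_sub hI1 hI2, integral_sub (hsm.const_inner _) (hsm'.const_inner _),
      integral_const_mul, integral_sub hd hd', integral_density (interior_subset hθi),
      integral_density (interior_subset hθi'), integral_inner hsm, integral_inner hsm',
      real_inner_comm, inner_sub_right]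
    simp [meanParam]
  rw [heq]
  refine (hQ (θ - θ') a).trans (integral_mono (integrable_mul_sq_inner_sub hb hωm hω hi _ _)
    (hI1.sub hI2) fun x => ?_)
  have h := mul_sq_le_exp_sub_mul_sub (hlow θ hθ x) (hlow θ' hθ' x)
  simp only [real_inner_smul_right]
  refine le_trans (le_of_eq ?_) (h.trans (le_of_eq ?_))
  · rw [inner_sub_left, ha]; ring
  · rw [inner_sub_left, ha]; simp only [density]; ring

/-- A convex function whose gradient is strongly monotone near `θ₀` grows at least linearly away
from its tangent plane at `θ₀`. -/
lemma linear_growth_of_strongMono {F : Type*} [NormedAddCommGroup F]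
    [InnerProductSpace ℝ F] [CompleteSpace F] {s : Set F} {f : F → ℝ} {g : F → F} {θ₀ : F}
    (hf : ConvexOn ℝ s f) {δ₀ c : ℝ} (hc : 0 ≤ c)
    (hg : ∀ θ ∈ Metric.ball θ₀ δ₀, HasGradientAt f (g θ) θ) (hs : Metric.ball θ₀ δ₀ ⊆ s)
    (hmono : ∀ θ ∈ Metric.ball θ₀ δ₀, ∀ θ' ∈ Metric.ball θ₀ δ₀,
      c * ‖θ - θ'‖ ^ 2 ≤ inner ℝ (g θ - g θ') (θ - θ'))
    {δ : ℝ} (hδ : 0 < δ) (hδ₀ : δ ≤ δ₀) {θ : F} (hθ : θ ∈ s) (hfar : δ ≤ ‖θ - θ₀‖) :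
    f θ₀ + inner ℝ (g θ₀) (θ - θ₀) + c * δ / 4 * ‖θ - θ₀‖ ≤ f θ := by
  set N := ‖θ - θ₀‖ with hN
  have hN0 : 0 < N := hδ.trans_le hfar
  -- `ξ` lies on the segment at distance `δ / 2` from `θ₀`. Chaining the tangent inequalities at
  -- `θ₀` and `ξ`, the gain in slope acts on the remaining `1 - τ ≥ 1 / 2` of the segment.
  set τ := δ / 2 / N with hτ
  have hτ0 : 0 < τ := by positivity
  have hτN : τ * N = δ / 2 := by rw [hτ]; field_simp
  have hτ1 : τ ≤ 1 / 2 := by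
    rw [hτ, div_le_iff₀ hN0]; linarith
  set ξ := θ₀ + τ • (θ - θ₀) with hξ
  have hξ0 : ξ - θ₀ = τ • (θ - θ₀) := by rw [hξ]; abel
  have hθξ : θ - ξ = (1 - τ) • (θ - θ₀) := by rw [hξ]; module
  have h0b : θ₀ ∈ Metric.ball θ₀ δ₀ := Metric.mem_ball_self (hδ.trans_le hδ₀)
  have hnξ : ‖ξ - θ₀‖ = δ / 2 := by
    rw [hξ0, norm_smul, Real.norm_of_nonneg hτ0.le, ← hN, hτN]
  have hξb : ξ ∈ Metric.ball θ₀ δ₀ := by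
    rw [Metric.mem_ball, dist_eq_norm, hnξ]; linarith
  have h1 := hf.add_inner_gradientWithin_le
    (hg ξ hξb).hasFDerivAt.hasFDerivWithinAt (hs hξb) hθ
  have h2 := hf.add_inner_gradientWithin_le
    (hg θ₀ h0b).hasFDerivAt.hasFDerivWithinAt (hs h0b) (hs hξb)
  have h3 := hmono ξ hξb θ₀ h0b
  rw [hnξ, hξ0, real_inner_smul_right, inner_sub_left] at h3
  rw [hθξ, real_inner_smul_right] at h1
  rw [hξ0, real_inner_smul_right] at h2
  set u := (inner ℝ (g ξ) (θ - θ₀) : ℝ)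
  set v := (inner ℝ (g θ₀) (θ - θ₀) : ℝ)
  have h4 : c * (δ / 2) * N ≤ u - v := by
    have h5 : τ * (c * (δ / 2) * N) ≤ τ * (u - v) := by
      have : τ * (c * (δ / 2) * N) = c * (δ / 2) ^ 2 := by
        rw [← hτN]; ring
      linarith
    exact le_of_mul_le_mul_left h5 hτ0
  have h6 : 1 / 2 * (c * (δ / 2) * N) ≤ (1 - τ) * (u - v) :=
    mul_le_mul (by linarith) h4 (by positivity) (by linarith)
  linarith

end Convexity

/-! ### Exponentially tilted sample means. -/

section Tilt

variable {n : ℕ}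

/-- The total weight of a sample tilted by `exp(ε θᵀ z)`. -/
def tiltMass (ε : ℝ) (z : Fin n → EuclideanSpace ℝ (Fin p)) (θ : EuclideanSpace ℝ (Fin p)) : ℝ :=
  ∑ i, Real.exp (ε * inner ℝ θ (z i))

/-- The weighted mean of a sample tilted by `exp(ε θᵀ z)`. -/
def tiltMean (ε : ℝ) (z : Fin n → EuclideanSpace ℝ (Fin p)) (θ : EuclideanSpace ℝ (Fin p)) :
    EuclideanSpace ℝ (Fin p) :=
  (tiltMass ε z θ)⁻¹ • ∑ i, Real.exp (ε * inner ℝ θ (z i)) • z i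

/-- A potential whose gradient is `tiltMean`. -/
def tiltPotential (ε : ℝ) (z : Fin n → EuclideanSpace ℝ (Fin p))
    (θ : EuclideanSpace ℝ (Fin p)) : ℝ :=
  if ε = 0 then (n : ℝ)⁻¹ * ∑ i, inner ℝ θ (z i) else ε⁻¹ * Real.log (tiltMass ε z θ)

lemma tiltMass_pos (hn : 0 < n) (ε : ℝ) (z : Fin n → EuclideanSpace ℝ (Fin p))
    (θ : EuclideanSpace ℝ (Fin p)) : 0 < tiltMass ε z θ := by
  have : Nonempty (Fin n) := ⟨⟨0, hn⟩⟩
  exact Finset.sum_pos (fun i _ => Real.exp_pos _) Finset.univ_nonempty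

lemma tiltMass_smul_tiltMean (hn : 0 < n) (ε : ℝ) (z : Fin n → EuclideanSpace ℝ (Fin p))
    (θ : EuclideanSpace ℝ (Fin p)) :
    tiltMass ε z θ • tiltMean ε z θ = ∑ i, Real.exp (ε * inner ℝ θ (z i)) • z i := by
  rw [tiltMean, smul_inv_smul₀ (tiltMass_pos hn ε z θ).ne']

lemma tiltMean_zero (ε : ℝ) (z : Fin n → EuclideanSpace ℝ (Fin p)) :
    tiltMean ε z 0 = (n : ℝ)⁻¹ • ∑ i, z i := by
  simp [tiltMean, tiltMass]

lemma hasGradientAt_tiltPotential (hn : 0 < n) (ε : ℝ) (z : Fin n → EuclideanSpace ℝ (Fin p))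
    (θ : EuclideanSpace ℝ (Fin p)) :
    HasGradientAt (tiltPotential ε z) (tiltMean ε z θ) θ := by
  rw [hasGradientAt_iff_hasFDerivAt]
  have hdual : InnerProductSpace.toDual ℝ _ (tiltMean ε z θ) =
      (tiltMass ε z θ)⁻¹ • ∑ i, Real.exp (ε * inner ℝ θ (z i)) • innerSL ℝ (z i) := by
    ext v
    simp [tiltMean]
  rw [hdual]
  by_cases hε : ε = 0
  · subst hε
    have h : HasFDerivAt (fun ϑ => (n : ℝ)⁻¹ * ∑ i, inner ℝ ϑ (z i))
        ((n : ℝ)⁻¹ • ∑ i, innerSL ℝ (z i)) θ :=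
      (HasFDerivAt.fun_sum fun i _ => hasFDerivAt_inner_left (z i) θ).const_mul _
    have e1 : tiltPotential 0 z = fun ϑ => (n : ℝ)⁻¹ * ∑ i, inner ℝ ϑ (z i) := by
      funext ϑ; simp [tiltPotential]
    rw [e1]
    simpa [tiltMass] using h
  · have hW : HasFDerivAt (tiltMass ε z)
        (∑ i, Real.exp (ε * inner ℝ θ (z i)) • ε • innerSL ℝ (z i)) θ :=
      HasFDerivAt.fun_sum fun i _ => ((hasFDerivAt_inner_left (z i) θ).const_mul ε).exp
    have h := (hW.log (tiltMass_pos hn ε z θ).ne').const_mul ε⁻¹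
    have e1 : tiltPotential ε z = fun ϑ => ε⁻¹ * Real.log (tiltMass ε z ϑ) := by
      funext ϑ; simp [tiltPotential, hε]
    have e2 : ε⁻¹ • (tiltMass ε z θ)⁻¹ •
        ∑ i, Real.exp (ε * inner ℝ θ (z i)) • ε • innerSL ℝ (z i) =
        (tiltMass ε z θ)⁻¹ • ∑ i, Real.exp (ε * inner ℝ θ (z i)) • innerSL ℝ (z i) := by
      rw [smul_comm ε⁻¹, Finset.smul_sum]
      congr 1
      refine Finset.sum_congr rfl fun i _ => ?_
      rw [smul_comm _ ε, inv_smul_smul₀ hε]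
    rw [e1, ← e2]
    exact h

lemma abs_exp_sub_exp_le {s t ρ : ℝ} (hs : s ≤ ρ) (ht : t ≤ ρ) :
    |Real.exp s - Real.exp t| ≤ |s - t| * Real.exp ρ := by
  wlog h : t ≤ s generalizing s t
  · rw [abs_sub_comm, abs_sub_comm s]
    exact this ht hs (le_of_not_ge h)
  rw [abs_of_nonneg (sub_nonneg.2 (Real.exp_le_exp.2 h)), abs_of_nonneg (sub_nonneg.2 h)]
  have h1 : Real.exp t = Real.exp s * Real.exp (t - s) := by rw [← Real.exp_add]; ring_nf
  have h2 := Real.add_one_le_exp (t - s)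
  have h3 : (s - t) * Real.exp s ≤ (s - t) * Real.exp ρ :=
    mul_le_mul_of_nonneg_left (Real.exp_le_exp.2 hs) (sub_nonneg.2 h)
  rw [h1]
  nlinarith [Real.exp_pos s]

lemma norm_mul_exp_le_expWeight (r : ℝ) (y : EuclideanSpace ℝ (Fin p)) :
    ‖y‖ * Real.exp (r * ‖y‖) ≤ expWeight r y := by
  refine mul_le_mul_of_nonneg_right ?_ (Real.exp_pos _).le
  nlinarith [norm_nonneg y]

/-- The tilted mean is Lipschitz in the parameter, with a constant proportional to `|ε|`. -/
lemma norm_tiltMean_sub_le (hn : 0 < n) {ε r D K : ℝ} {z : Fin n → EuclideanSpace ℝ (Fin p)}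
    (hK : (n : ℝ)⁻¹ * ∑ i, expWeight r (z i) ≤ K) (hεr : |ε| * D ≤ r) (hεK : |ε| * D * K ≤ 1 / 2)
    {θ θ' : EuclideanSpace ℝ (Fin p)} (hθ : ‖θ‖ ≤ D) (hθ' : ‖θ'‖ ≤ D) :
    ‖tiltMean ε z θ - tiltMean ε z θ'‖ ≤ 2 * |ε| * K * (1 + 2 * K) * ‖θ - θ'‖ := by
  have hn' : (0 : ℝ) < n := Nat.cast_pos.2 hn
  have hS : ∑ i, expWeight r (z i) ≤ K * n := by
    rwa [inv_mul_le_iff₀ hn', mul_comm] at hK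
  have hK0 : 0 ≤ K :=
    le_trans (mul_nonneg (by positivity) (Finset.sum_nonneg fun i _ => expWeight_nonneg _ _)) hK
  have hexp : ∀ θ : EuclideanSpace ℝ (Fin p), ‖θ‖ ≤ D → ∀ i, ε * inner ℝ θ (z i) ≤ r * ‖z i‖ := by
    intro θ hθ i
    calc ε * inner ℝ θ (z i) ≤ |ε| * (‖θ‖ * ‖z i‖) := by
          refine (le_abs_self _).trans ?_
          rw [abs_mul]
          exact mul_le_mul_of_nonneg_left (abs_real_inner_le_norm _ _) (abs_nonneg _)
      _ ≤ |ε| * (D * ‖z i‖) := by gcongr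
      _ = |ε| * D * ‖z i‖ := by ring
      _ ≤ r * ‖z i‖ := by gcongr
  have hdiff : ∀ θ θ' : EuclideanSpace ℝ (Fin p), ‖θ‖ ≤ D → ‖θ'‖ ≤ D → ∀ i,
      |Real.exp (ε * inner ℝ θ (z i)) - Real.exp (ε * inner ℝ θ' (z i))| ≤
        |ε| * ‖θ - θ'‖ * (‖z i‖ * Real.exp (r * ‖z i‖)) := by
    intro θ θ' hθ hθ' i
    refine (abs_exp_sub_exp_le (hexp θ hθ i) (hexp θ' hθ' i)).trans ?_
    rw [← mul_sub, ← inner_sub_left, abs_mul]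
    calc |ε| * |inner ℝ (θ - θ') (z i)| * Real.exp (r * ‖z i‖)
        ≤ |ε| * (‖θ - θ'‖ * ‖z i‖) * Real.exp (r * ‖z i‖) := by
          gcongr; exact abs_real_inner_le_norm (θ - θ') (z i)
      _ = _ := by ring
  have hW : ∀ θ θ' : EuclideanSpace ℝ (Fin p), ‖θ‖ ≤ D → ‖θ'‖ ≤ D →
      |tiltMass ε z θ - tiltMass ε z θ'| ≤ |ε| * ‖θ - θ'‖ * (K * n) := by
    intro θ θ' hθ hθ'
    rw [tiltMass, tiltMass, ← Finset.sum_sub_distrib]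
    refine (Finset.abs_sum_le_sum_abs _ _).trans (le_trans (Finset.sum_le_sum fun i _ =>
      (hdiff θ θ' hθ hθ' i).trans (mul_le_mul_of_nonneg_left (norm_mul_exp_le_expWeight r (z i))
        (by positivity))) ?_)
    rw [← Finset.mul_sum]
    gcongr
  have hV : ‖(∑ i, Real.exp (ε * inner ℝ θ (z i)) • z i) -
      ∑ i, Real.exp (ε * inner ℝ θ' (z i)) • z i‖ ≤ |ε| * ‖θ - θ'‖ * (K * n) := by
    rw [← Finset.sum_sub_distrib]
    refine (norm_sum_le _ _).trans (le_trans (Finset.sum_le_sum (g := fun i =>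
      |ε| * ‖θ - θ'‖ * expWeight r (z i)) fun i _ => ?_) ?_)
    · rw [← sub_smul, norm_smul, Real.norm_eq_abs]
      refine (mul_le_mul_of_nonneg_right (hdiff θ θ' hθ hθ' i) (norm_nonneg _)).trans ?_
      rw [mul_assoc]
      refine mul_le_mul_of_nonneg_left ?_ (by positivity)
      rw [expWeight, mul_right_comm]
      refine mul_le_mul_of_nonneg_right ?_ (Real.exp_pos _).le
      nlinarith [norm_nonneg (z i)]
    · rw [← Finset.mul_sum]
      gcongr
  -- At the parameter `0` the mass is exactly `n`, and the smallness of `|ε| * D * K` lets it lose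
  -- at most half.
  have hlow : ∀ θ : EuclideanSpace ℝ (Fin p), ‖θ‖ ≤ D → (n : ℝ) / 2 ≤ tiltMass ε z θ := by
    intro θ hθ
    have h1 := hW θ 0 hθ (by simpa using (norm_nonneg θ).trans hθ)
    have h2 : tiltMass ε z 0 = n := by simp [tiltMass]
    rw [h2, sub_zero] at h1
    have h3 : |ε| * ‖θ‖ * (K * n) ≤ |ε| * D * (K * n) := by gcongr
    have h4 : |ε| * D * (K * n) ≤ 1 / 2 * n := by
      rw [← mul_assoc]; gcongr
    linarith [(abs_le.1 h1).1]
  have hV' : ‖∑ i, Real.exp (ε * inner ℝ θ' (z i)) • z i‖ ≤ K * n := by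
    refine (norm_sum_le _ _).trans (le_trans (Finset.sum_le_sum fun i _ => ?_) hS)
    rw [norm_smul, Real.norm_of_nonneg (Real.exp_pos _).le, mul_comm]
    refine le_trans ?_ (norm_mul_exp_le_expWeight r (z i))
    have := hexp θ' hθ' i
    gcongr
  have hB' : ‖tiltMean ε z θ'‖ ≤ 2 * K := by
    have h1 := tiltMass_smul_tiltMean hn ε z θ'
    rw [← h1, norm_smul, Real.norm_of_nonneg (tiltMass_pos hn ε z θ').le] at hV'
    have h2 : (n : ℝ) / 2 * ‖tiltMean ε z θ'‖ ≤ K * n :=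
      (mul_le_mul_of_nonneg_right (hlow θ' hθ') (norm_nonneg _)).trans hV'
    have h3 : (n : ℝ) / 2 * ‖tiltMean ε z θ'‖ ≤ (n : ℝ) / 2 * (2 * K) := by linarith
    exact le_of_mul_le_mul_left h3 (by positivity)
  -- Quotient rule without division: the mass bound `n / 2` can then be divided out at the end.
  have hid : tiltMass ε z θ • (tiltMean ε z θ - tiltMean ε z θ') =
      ((∑ i, Real.exp (ε * inner ℝ θ (z i)) • z i) -
        ∑ i, Real.exp (ε * inner ℝ θ' (z i)) • z i) -
      (tiltMass ε z θ - tiltMass ε z θ') • tiltMean ε z θ' := by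
    rw [← tiltMass_smul_tiltMean hn ε z θ, ← tiltMass_smul_tiltMean hn ε z θ']
    module
  have hfin : (n : ℝ) / 2 * ‖tiltMean ε z θ - tiltMean ε z θ'‖ ≤
      |ε| * ‖θ - θ'‖ * (K * n) + |ε| * ‖θ - θ'‖ * (K * n) * (2 * K) := by
    calc (n : ℝ) / 2 * ‖tiltMean ε z θ - tiltMean ε z θ'‖
        ≤ tiltMass ε z θ * ‖tiltMean ε z θ - tiltMean ε z θ'‖ := by
          gcongr; exact hlow θ hθ
      _ = ‖tiltMass ε z θ • (tiltMean ε z θ - tiltMean ε z θ')‖ := by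
          rw [norm_smul, Real.norm_of_nonneg (tiltMass_pos hn ε z θ).le]
      _ ≤ _ := by
          rw [hid]
          refine (norm_sub_le _ _).trans (add_le_add hV ?_)
          rw [norm_smul, Real.norm_eq_abs]
          exact mul_le_mul (hW θ θ' hθ hθ') hB' (norm_nonneg _) (by positivity)
  have h3 : (n : ℝ) / 2 * ‖tiltMean ε z θ - tiltMean ε z θ'‖ ≤
      (n : ℝ) / 2 * (2 * |ε| * K * (1 + 2 * K) * ‖θ - θ'‖) := by linarith
  exact le_of_mul_le_mul_left h3 (by positivity)

end Tilt

/-! ### The deterministic argument for a fixed sample. -/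

section Sample

variable {μ : Measure Ω} {b : Ω → EuclideanSpace ℝ (Fin p)} {n : ℕ} {x : Fin n → Ω}

/-- The `Lq`-likelihood is an increasing function of a difference of potentials. -/
lemma exists_strictMono_lqLikelihood_eq (hn : 0 < n) (q : ℝ) (x : Fin n → Ω) :
    ∃ Φ : ℝ → ℝ, StrictMono Φ ∧ ∀ θ, lqLikelihood μ b q x θ =
      Φ (tiltPotential (1 - q) (fun i => b (x i)) θ - logNormalizer μ b θ) := by
  have hn' : (0 : ℝ) < n := Nat.cast_pos.2 hn
  by_cases hq : q = 1
  · refine ⟨fun y => n * y, fun y y' h => mul_lt_mul_of_pos_left h hn', fun θ => ?_⟩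
    simp only [lqLikelihood, Lq, hq, if_true, log_density, tiltPotential, sub_self,
      Finset.sum_sub_distrib, Finset.sum_const, Finset.card_univ, Fintype.card_fin, nsmul_eq_mul]
    field_simp
  -- The sign of `1 - q` enters both the exponent and the denominator, so the map increases in
  -- either case.
  · have hε : 1 - q ≠ 0 := sub_ne_zero.2 (Ne.symm hq)
    refine ⟨fun y => (Real.exp ((1 - q) * y) - n) / (1 - q), ?_, fun θ => ?_⟩
    · intro y y' h
      rcases lt_or_gt_of_ne hε with h0 | h0
      · have := Real.exp_lt_exp.2 (mul_lt_mul_of_neg_left h h0)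
        exact div_lt_div_of_neg_of_lt h0 (by linarith)
      · have := Real.exp_lt_exp.2 (mul_lt_mul_of_pos_left h h0)
        exact div_lt_div_of_pos_right (by linarith) h0
    · have h1 : Real.exp ((1 - q) * (tiltPotential (1 - q) (fun i => b (x i)) θ
          - logNormalizer μ b θ)) =
          ∑ i, density μ b θ (x i) ^ (1 - q) := by
        rw [tiltPotential, if_neg hε, mul_sub, mul_inv_cancel_left₀ hε, Real.exp_sub,
          Real.exp_log (tiltMass_pos hn _ _ _), tiltMass, Finset.sum_div]
        refine Finset.sum_congr rfl fun i _ => ?_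
        rw [density, ← Real.exp_mul, ← Real.exp_sub]
        congr 1; ring
      simp only [lqLikelihood, Lq, hq, if_false]
      rw [h1, ← Finset.sum_div, Finset.sum_sub_distrib]
      simp

lemma hasGradientWithinAt_log_density_iff {s : Set (EuclideanSpace ℝ (Fin p))}
    {g θ : EuclideanSpace ℝ (Fin p)} (y : Ω) :
    HasGradientWithinAt (fun ϑ => Real.log (density μ b ϑ y)) (b y - g) s θ ↔
      HasGradientWithinAt (logNormalizer μ b) g s θ := by
  have hin : HasFDerivWithinAt (fun ϑ => inner ℝ ϑ (b y))
      (InnerProductSpace.toDual ℝ (EuclideanSpace ℝ (Fin p)) (b y)) s θ :=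
    (hasFDerivAt_inner_left (b y) θ).hasFDerivWithinAt
  simp only [hasGradientWithinAt_iff_hasFDerivWithinAt, log_density, map_sub]
  constructor
  · intro h
    have := hin.sub h
    rw [sub_sub_cancel] at this
    exact this.congr (fun ϑ _ => by simp) (by simp)
  · intro h
    exact hin.sub h

/-- Inside a convex natural parameter space with nonempty interior, the solutions of the
`Lq`-likelihood equation are the points at which the tilted sample mean is the gradient of the
log normalizer. -/
lemma mem_lqSolutions_iff (hN : Convex ℝ (natParamSpace μ b))
    (hint : (interior (natParamSpace μ b)).Nonempty) {Θ : Set (EuclideanSpace ℝ (Fin p))}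
    (hΘ : Θ ⊆ natParamSpace μ b) (hn : 0 < n) {q : ℝ} {θ : EuclideanSpace ℝ (Fin p)} :
    θ ∈ lqSolutions μ b Θ q x ↔ θ ∈ Θ ∧ HasGradientWithinAt (logNormalizer μ b)
      (tiltMean (1 - q) (fun i => b (x i)) θ) (natParamSpace μ b) θ := by
  have hsum : ∀ g, θ ∈ Θ → HasGradientWithinAt (logNormalizer μ b) g (natParamSpace μ b) θ →
      (∑ i, lqScore μ b q θ (x i) = 0 ↔ g = tiltMean (1 - q) (fun i => b (x i)) θ) := by
    intro g hθ hg
    -- Convexity with nonempty interior makes the relative gradient unique, also at boundary points.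
    have hu : UniqueDiffWithinAt ℝ (natParamSpace μ b) θ := uniqueDiffOn_convex hN hint θ (hΘ hθ)
    have hscore : ∀ i, score μ b θ (x i) = b (x i) - g := by
      intro i
      have h1 := (hasGradientWithinAt_log_density_iff (x i)).2 hg
      refine (InnerProductSpace.toDual ℝ (EuclideanSpace ℝ (Fin p))).injective ?_
      rw [score, toDual_gradientWithin]
      exact h1.hasFDerivWithinAt.fderivWithin hu
    have hpow : ∀ i, density μ b θ (x i) ^ (1 - q) =
        Real.exp (-(1 - q) * logNormalizer μ b θ) * Real.exp ((1 - q) * inner ℝ θ (b (x i))) := by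
      intro i
      rw [density, ← Real.exp_mul, ← Real.exp_add]
      congr 1; ring
    have hs : ∑ i, lqScore μ b q θ (x i) = Real.exp (-(1 - q) * logNormalizer μ b θ) •
        tiltMass (1 - q) (fun i => b (x i)) θ •
          (tiltMean (1 - q) (fun i => b (x i)) θ - g) := by
      rw [smul_sub, tiltMass_smul_tiltMean hn, tiltMass, Finset.sum_smul,
        ← Finset.sum_sub_distrib, Finset.smul_sum]
      refine Finset.sum_congr rfl fun i _ => ?_
      rw [lqScore, hscore, hpow, mul_smul, smul_sub]
    rw [hs, smul_eq_zero_iff_right (Real.exp_pos _).ne',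
      smul_eq_zero_iff_right (tiltMass_pos hn _ _ _).ne', sub_eq_zero, eq_comm]
  constructor
  · rintro ⟨hθ, hdiff, h0⟩
    have hg := (hdiff ⟨0, hn⟩).hasGradientWithinAt
    set g' := gradientWithin (fun ϑ => Real.log (density μ b ϑ (x ⟨0, hn⟩))) (natParamSpace μ b) θ
    have hg2 : HasGradientWithinAt (logNormalizer μ b) (b (x ⟨0, hn⟩) - g')
        (natParamSpace μ b) θ := by
      rw [← hasGradientWithinAt_log_density_iff (x ⟨0, hn⟩)]
      simpa using hg
    exact ⟨hθ, (hsum _ hθ hg2).1 h0 ▸ hg2⟩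
  · rintro ⟨hθ, hg⟩
    exact ⟨hθ, fun i =>
      ((hasGradientWithinAt_log_density_iff (x i)).2 hg).differentiableWithinAt,
      (hsum _ hθ hg).2 rfl⟩

/-- Uniqueness and localization of the maximum `Lq`-likelihood estimate for a sample whose tilted
means are close to the mean at `θ₀` and vary slowly with the parameter. -/
theorem exists_isUniqueMLqE [NeZero μ] (hb : Measurable b)
    (hint : (interior (natParamSpace μ b)).Nonempty) {Θ : Set (EuclideanSpace ℝ (Fin p))}
    (hΘ : Θ ⊆ natParamSpace μ b) {θ₀ : EuclideanSpace ℝ (Fin p)} {c δ₀ δ R q : ℝ} (hc : 0 < c)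
    (hball : Metric.ball θ₀ δ₀ ⊆ interior (natParamSpace μ b))
    (hmono : ∀ θ ∈ Metric.ball θ₀ δ₀, ∀ θ' ∈ Metric.ball θ₀ δ₀,
      c * ‖θ - θ'‖ ^ 2 ≤ inner ℝ (meanParam μ b θ - meanParam μ b θ') (θ - θ'))
    (hδ : 0 < δ) (hδ₀ : δ < δ₀) (hδΘ : Metric.closedBall θ₀ δ ⊆ Θ)
    (hR : Θ ⊆ Metric.closedBall θ₀ R) (hn : 0 < n)
    (hclose : ∀ θ ∈ Metric.closedBall θ₀ R,
      ‖tiltMean (1 - q) (fun i => b (x i)) θ - meanParam μ b θ₀‖ ≤ c * δ / 8)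
    (hlip : ∀ θ ∈ Metric.closedBall θ₀ R, ∀ θ' ∈ Metric.closedBall θ₀ R,
      ‖tiltMean (1 - q) (fun i => b (x i)) θ - tiltMean (1 - q) (fun i => b (x i)) θ'‖ ≤
        c / 2 * ‖θ - θ'‖) :
    ∃ t, IsUniqueMLqE μ b Θ q x t ∧ dist t θ₀ < δ := by
  have hconv := convexOn_logNormalizer (μ := μ) hb
  set B := tiltMean (1 - q) (fun i => b (x i)) with hB
  set G := tiltPotential (1 - q) (fun i => b (x i)) with hG
  set A := logNormalizer μ b with hA
  have hGgrad : ∀ θ, HasGradientAt G (B θ) θ := hasGradientAt_tiltPotential hn _ _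
  have hAgrad : ∀ θ ∈ Metric.ball θ₀ δ₀, HasGradientAt A (meanParam μ b θ) θ := fun θ hθ =>
    hasGradientAt_logNormalizer hb (hball hθ)
  have hsol : ∀ θ, θ ∈ lqSolutions μ b Θ q x ↔ θ ∈ Θ ∧
      HasGradientWithinAt A (B θ) (natParamSpace μ b) θ := fun θ =>
    mem_lqSolutions_iff hconv.1 hint hΘ hn
  have hgrow : ∀ θ ∈ Θ, δ ≤ ‖θ - θ₀‖ →
      A θ₀ + inner ℝ (meanParam μ b θ₀) (θ - θ₀) + c * δ / 4 * ‖θ - θ₀‖ ≤ A θ := fun θ hθ hfar =>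
    linear_growth_of_strongMono hconv hc.le hAgrad (hball.trans interior_subset) hmono hδ hδ₀.le
      (hΘ hθ) hfar
  have hθ₀Θ : θ₀ ∈ Θ := hδΘ (Metric.mem_closedBall_self hδ.le)
  have hfar : ∀ θ ∈ Θ, δ ≤ ‖θ - θ₀‖ → G θ - A θ < G θ₀ - A θ₀ := by
    intro θ hθ hfar
    -- The mean value inequality is used on the ball of radius `R` because `Θ` need not be convex.
    -- The slope `c * δ / 8` is half the growth rate of `A`.
    have h1 : ‖(G θ - inner ℝ (meanParam μ b θ₀) θ) - (G θ₀ - inner ℝ (meanParam μ b θ₀) θ₀)‖ ≤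
        c * δ / 8 * ‖θ - θ₀‖ := by
      refine (convex_closedBall θ₀ R).norm_image_sub_le_of_norm_hasFDerivWithin_le
        (f := fun ϑ => G ϑ - inner ℝ (meanParam μ b θ₀) ϑ)
        (f' := fun ϑ => innerSL ℝ (B ϑ - meanParam μ b θ₀))
        (fun ϑ hϑ => ?_) (fun ϑ hϑ => ?_) (hR hθ₀Θ) (hR hθ)
      · rw [map_sub]
        exact ((hGgrad ϑ).hasFDerivAt.sub
          (innerSL ℝ (meanParam μ b θ₀)).hasFDerivAt).hasFDerivWithinAt
      · rw [innerSL_apply_norm]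
        exact hclose ϑ hϑ
    have h2 := hgrow θ hθ hfar
    rw [inner_sub_right] at h2
    have h3 := (abs_le.1 h1).2
    have h4 : 0 < c * δ / 8 * ‖θ - θ₀‖ := by
      have : 0 < ‖θ - θ₀‖ := hδ.trans_le hfar
      positivity
    linarith
  -- A far solution would have `B θ` as a subgradient of `A`; evaluated at `θ₀`, this contradicts
  -- the linear growth, as `B θ` is too close to the mean at `θ₀`.
  have hsolnear : ∀ θ ∈ lqSolutions μ b Θ q x, dist θ θ₀ < δ := by
    intro θ hθ
    obtain ⟨hθΘ, hg⟩ := (hsol θ).1 hθ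
    by_contra! hd
    rw [dist_eq_norm] at hd
    have h1 := hconv.add_inner_gradientWithin_le hg (hΘ hθΘ) (hΘ hθ₀Θ)
    have h2 := hgrow θ hθΘ hd
    have h3 := real_inner_le_norm (B θ - meanParam μ b θ₀) (θ - θ₀)
    have h4 := mul_le_mul_of_nonneg_right (hclose θ (hR hθΘ)) (norm_nonneg (θ - θ₀))
    rw [inner_sub_left] at h3
    rw [← neg_sub θ θ₀, inner_neg_right] at h1
    have h5 : 0 < c * δ / 8 * ‖θ - θ₀‖ := by
      have : 0 < ‖θ - θ₀‖ := hδ.trans_le hd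
      positivity
    linarith
  have hsoleq : ∀ θ ∈ lqSolutions μ b Θ q x, B θ = meanParam μ b θ := by
    intro θ hθ
    have hθb : θ ∈ Metric.ball θ₀ δ₀ := (hsolnear θ hθ).trans hδ₀
    have h1 : HasGradientAt A (B θ) θ :=
      ((hsol θ).1 hθ).2.hasFDerivWithinAt.hasFDerivAt
        (mem_interior_iff_mem_nhds.1 (hball hθb))
    exact h1.unique (hAgrad θ hθb)
  -- Monotonicity with constant `c` against a Lipschitz constant `c / 2` forces the two solutions to
  -- coincide.
  have hsoluniq : ∀ θ ∈ lqSolutions μ b Θ q x, ∀ θ' ∈ lqSolutions μ b Θ q x, θ = θ' := by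
    intro θ hθ θ' hθ'
    have h1 := hmono θ ((hsolnear θ hθ).trans hδ₀) θ' ((hsolnear θ' hθ').trans hδ₀)
    rw [← hsoleq θ hθ, ← hsoleq θ' hθ'] at h1
    have h2 := real_inner_le_norm (B θ - B θ') (θ - θ')
    have h3 := mul_le_mul_of_nonneg_right (hlip θ (hR hθ.1) θ' (hR hθ'.1)) (norm_nonneg (θ - θ'))
    have h4 : c / 2 * ‖θ - θ'‖ ^ 2 ≤ 0 := by nlinarith
    have h5 : ‖θ - θ'‖ ^ 2 ≤ 0 := nonpos_of_mul_nonpos_right h4 (by positivity)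
    exact sub_eq_zero.1 (norm_eq_zero.1 (pow_eq_zero_iff two_ne_zero |>.1
      (le_antisymm h5 (sq_nonneg _))))
  have hmaxsol : ∀ t, dist t θ₀ < δ → (∀ θ ∈ Metric.closedBall θ₀ δ, G θ - A θ ≤ G t - A t) →
      t ∈ lqSolutions μ b Θ q x := by
    intro t ht hmax
    have htb : t ∈ Metric.ball θ₀ δ₀ := ht.trans hδ₀
    have hd : HasFDerivAt (fun θ => G θ - A θ) (innerSL ℝ (B t - meanParam μ b t)) t := by
      rw [map_sub]; exact (hGgrad t).hasFDerivAt.sub (hAgrad t htb).hasFDerivAt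
    have hloc : IsLocalMax (fun θ => G θ - A θ) t := by
      filter_upwards [Metric.isOpen_ball.mem_nhds (Metric.mem_ball.2 ht)] with θ hθ
      exact hmax θ (Metric.ball_subset_closedBall hθ)
    have h0 := hloc.hasFDerivAt_eq_zero hd
    have h1 : B t = meanParam μ b t := by
      rw [← sub_eq_zero, ← norm_eq_zero, ← innerSL_apply_norm ℝ, h0, norm_zero]
    refine (hsol t).2 ⟨hδΘ (Metric.mem_closedBall.2 ht.le), ?_⟩
    rw [h1]
    exact (hAgrad t htb).hasFDerivAt.hasFDerivWithinAt
  obtain ⟨t, htmem, htmax⟩ := (isCompact_closedBall θ₀ δ).exists_isMaxOn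
    (f := fun θ => G θ - A θ) ⟨θ₀, Metric.mem_closedBall_self hδ.le⟩ fun θ hθ =>
      ((hGgrad θ).differentiableAt.continuousAt.sub (hAgrad θ
        (lt_of_le_of_lt hθ hδ₀)).differentiableAt.continuousAt).continuousWithinAt
  have ht₀ : G θ₀ - A θ₀ ≤ G t - A t := htmax (Metric.mem_closedBall_self hδ.le)
  have htnear : dist t θ₀ < δ := by
    by_contra! hd
    exact absurd (hfar t (hδΘ htmem) (by rwa [← dist_eq_norm])) (not_lt.2 ht₀)
  have htsol := hmaxsol t htnear fun θ hθ => htmax hθ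
  obtain ⟨Φ, hΦ, hL⟩ := exists_strictMono_lqLikelihood_eq (μ := μ) (b := b) hn q x
  have hmem : ∀ s, s ∈ lqMaximizers μ b Θ q x ↔
      s ∈ Θ ∧ ∀ θ ∈ Θ, G θ - A θ ≤ G s - A s := by
    intro s
    simp only [lqMaximizers, Set.mem_ofPred_eq, isMaxOn_iff, hL, hΦ.le_iff_le, ← hG, ← hA]
  refine ⟨t, ⟨?_, ?_⟩, htnear⟩
  · exact Set.eq_singleton_iff_unique_mem.2 ⟨htsol, fun s hs => hsoluniq s hs t htsol⟩
  · refine Set.eq_singleton_iff_unique_mem.2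
      ⟨(hmem t).2 ⟨hδΘ htmem, fun θ hθ => ?_⟩, fun s hs => ?_⟩
    · rcases lt_or_ge (dist θ θ₀) δ with h | h
      · exact htmax (Metric.mem_closedBall.2 h.le)
      · exact (hfar θ hθ (by rwa [← dist_eq_norm])).le.trans ht₀
    -- Any other maximizer is also near `θ₀`, hence a critical point, so uniqueness of solutions
    -- applies.
    · obtain ⟨hsΘ, hsmax⟩ := (hmem s).1 hs
      refine hsoluniq s (hmaxsol s ?_ fun θ hθ => hsmax θ (hδΘ hθ)) t htsol
      by_contra! hd
      exact absurd (hfar s hsΘ (by rwa [← dist_eq_norm])) (not_lt.2 (hsmax θ₀ hθ₀Θ))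

end Sample

/-! ### The law of large numbers and the probability of good samples. -/

section Consistency

variable {μ : Measure Ω} {b : Ω → EuclideanSpace ℝ (Fin p)} {θ₀ : EuclideanSpace ℝ (Fin p)}

lemma integrable_expFamily_iff {F : Type*} [NormedAddCommGroup F] [NormedSpace ℝ F]
    (hb : Measurable b) (θ : EuclideanSpace ℝ (Fin p)) (g : Ω → F) :
    Integrable g (expFamily μ b θ) ↔ Integrable (fun x => density μ b θ x • g x) μ := by
  rw [expFamily, integrable_withDensity_iff_integrable_smul'
    (measurable_density hb θ).ennreal_ofReal (.of_forall fun x => ENNReal.ofReal_lt_top)]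
  simp_rw [ENNReal.toReal_ofReal (density_pos θ _).le]

lemma integral_expFamily {F : Type*} [NormedAddCommGroup F] [NormedSpace ℝ F]
    (hb : Measurable b) (θ : EuclideanSpace ℝ (Fin p)) (g : Ω → F) :
    ∫ x, g x ∂(expFamily μ b θ) = ∫ x, density μ b θ x • g x ∂μ := by
  rw [expFamily, integral_withDensity_eq_integral_toReal_smul
    (measurable_density hb θ).ennreal_ofReal (.of_forall fun x => ENNReal.ofReal_lt_top)]
  simp_rw [ENNReal.toReal_ofReal (density_pos θ _).le]

variable {S : Type*} [MeasurableSpace S] {P : Measure S} [IsProbabilityMeasure P] {X : ℕ → S → Ω}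

/-- The weak law of large numbers for a function of an i.i.d. sequence with a given law. -/
lemma tendstoInMeasure_sampleMean {F : Type*} [NormedAddCommGroup F] [NormedSpace ℝ F]
    [CompleteSpace F] [MeasurableSpace F] [BorelSpace F] [SecondCountableTopology F]
    {ν : Measure Ω} (hindep : iIndepFun X P) (hlaw : ∀ i, HasLaw (X i) ν P)
    {g : Ω → F} (hg : Measurable g) (hint : Integrable g ν) :
    TendstoInMeasure P (fun (n : ℕ) s => (n : ℝ)⁻¹ • ∑ i : Fin n, g (X i s)) atTop
      (fun _ => ∫ x, g x ∂ν) := by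
  have hXm : ∀ i, AEMeasurable (fun s => g (X i s)) P := fun i =>
    hg.comp_aemeasurable (hlaw i).aemeasurable
  have hident : ∀ i, IdentDistrib (fun s => g (X i s)) (fun s => g (X 0 s)) P P := fun i =>
    IdentDistrib.comp ⟨(hlaw i).aemeasurable, (hlaw 0).aemeasurable,
      (hlaw i).map_eq.trans (hlaw 0).map_eq.symm⟩ hg
  have hint0 : Integrable (fun s => g (X 0 s)) P := by
    have h := hint
    rw [← (hlaw 0).map_eq] at h
    exact h.comp_aemeasurable (hlaw 0).aemeasurable
  have hsl := strong_law_ae (μ := P) (fun i s => g (X i s)) hint0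
    (fun i j hij => (hindep.indepFun hij).comp hg hg) hident
  have hmean : ∫ s, g (X 0 s) ∂P = ∫ x, g x ∂ν :=
    (hlaw 0).integral_comp hint.aestronglyMeasurable
  refine tendstoInMeasure_of_tendsto_ae (fun n => ?_) ?_
  · exact ((Finset.aemeasurable_fun_sum _ fun (i : Fin n) _ => hXm i).const_smul
      _).aestronglyMeasurable
  · filter_upwards [hsl] with s hs
    rw [hmean] at hs
    simpa only [Finset.sum_range] using hs

/-- The exceptional samples are covered by two law-of-large-numbers events, one for `b` and one for
the exponential weight; all other smallness comes from `q n → 1`. -/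
lemma tendsto_measure_not_isUniqueMLqE_near [NeZero μ] (hb : Measurable b)
    (hrank : FullRank μ b) {Θ : Set (EuclideanSpace ℝ (Fin p))}
    (hΘ : Θ ⊆ natParamSpace μ b) (hcompact : IsCompact Θ) (hθ₀ : θ₀ ∈ interior Θ)
    {q : ℕ → ℝ} (hq : Tendsto q atTop (𝓝 1)) (hindep : iIndepFun X P)
    (hlaw : ∀ i, HasLaw (X i) (expFamily μ b θ₀) P) {η : ℝ} (hη : 0 < η) :
    Tendsto (fun n : ℕ => P {s | ¬ ∃ t,
      IsUniqueMLqE μ b Θ (q n) (fun i : Fin n => X i s) t ∧ dist t θ₀ < η}) atTop (𝓝 0) := by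
  have hθ₀N : θ₀ ∈ interior (natParamSpace μ b) := interior_mono hΘ hθ₀
  obtain ⟨δ₀, hδ₀, c, hc, hball, hmono⟩ := exists_strongMono_meanParam hrank hb hθ₀N
  obtain ⟨ρ, hρ, hρΘ⟩ := Metric.mem_nhds_iff.1 (mem_interior_iff_mem_nhds.1 hθ₀)
  obtain ⟨δ, hδ, hδlt⟩ : ∃ δ, 0 < δ ∧ δ < min η (min δ₀ ρ) :=
    exists_between (lt_min hη (lt_min hδ₀ hρ))
  -- The radius is below `η` for consistency, below `δ₀` for strong monotonicity, and below `ρ` to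
  -- stay inside `Θ`.
  obtain ⟨hδη, hδ1⟩ := lt_min_iff.1 hδlt
  obtain ⟨hδδ₀, hδρ⟩ := lt_min_iff.1 hδ1
  obtain ⟨R, hR⟩ := hcompact.isBounded.subset_closedBall θ₀
  set D := ‖θ₀‖ + |R| with hD
  have hD0 : 0 ≤ D := by positivity
  have hDR : ∀ θ ∈ Metric.closedBall θ₀ R, ‖θ‖ ≤ D := by
    intro θ hθ
    have h1 := norm_le_norm_add_norm_sub' θ θ₀
    have h2 : ‖θ - θ₀‖ ≤ R := by simpa [dist_eq_norm] using hθ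
    linarith [le_abs_self R]
  obtain ⟨r, hr, hint⟩ := exists_integrable_expWeight hb hθ₀N
  have hL1 := tendstoInMeasure_sampleMean hindep hlaw hb
    ((integrable_expFamily_iff hb θ₀ b).2 (integrable_density_smul hb hθ₀N))
  rw [integral_expFamily hb θ₀ b] at hL1
  have hL2 := tendstoInMeasure_sampleMean hindep hlaw ((measurable_expWeight r).comp hb)
    ((integrable_expFamily_iff hb θ₀ (expWeight r ∘ b)).2 hint)
  set K₀ := ∫ x, (expWeight r ∘ b) x ∂(expFamily μ b θ₀) with hK₀
  set K := K₀ + 1 with hK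
  have hε : Tendsto (fun n => |1 - q n|) atTop (𝓝 0) := by
    have : Tendsto (fun n => |1 - q n|) atTop (𝓝 |1 - 1|) := (hq.const_sub 1).abs
    simpa using this
  have hsmall : ∀ (a : ℝ) {e : ℝ}, 0 < e → ∀ᶠ n in atTop, |1 - q n| * a < e := by
    intro a e he
    have : Tendsto (fun n => |1 - q n| * a) atTop (𝓝 0) := by simpa using hε.mul_const a
    exact this.eventually (gt_mem_nhds he)
  -- Half of the tolerance `c * δ / 8` goes to the sample mean and half to the tilt.
  have hκ : 0 < c * δ / 16 := by positivity
  have hlim := (tendstoInMeasure_iff_dist.1 hL1 (c * δ / 16) hκ).add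
    (tendstoInMeasure_iff_dist.1 hL2 1 one_pos)
  rw [add_zero] at hlim
  refine tendsto_of_tendsto_of_tendsto_of_le_of_le' tendsto_const_nhds hlim
    (.of_forall fun n => zero_le) ?_
  filter_upwards [eventually_gt_atTop 0, hsmall D hr, hsmall (D * K) (e := 1 / 2) (by norm_num),
    hsmall (2 * K * (1 + 2 * K)) (e := c / 2) (by positivity),
    hsmall (2 * K * (1 + 2 * K) * D) hκ] with n hn h1 h2 h3 h4
  refine (measure_mono fun s hs => ?_).trans (measure_union_le _ _)
  by_contra hgood
  simp only [Set.mem_union, Set.mem_ofPred_eq, not_or, not_le] at hgood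
  obtain ⟨hg1, hg2⟩ := hgood
  refine hs ?_
  have hKs : (n : ℝ)⁻¹ * ∑ i : Fin n, expWeight r (b (X i s)) ≤ K := by
    rw [Real.dist_eq] at hg2
    simp only [smul_eq_mul, Function.comp_apply] at hg2
    linarith [(abs_lt.1 hg2).2]
  have hlip : ∀ θ θ' : EuclideanSpace ℝ (Fin p), ‖θ‖ ≤ D → ‖θ'‖ ≤ D →
      ‖tiltMean (1 - q n) (fun i : Fin n => b (X i s)) θ -
        tiltMean (1 - q n) (fun i : Fin n => b (X i s)) θ'‖ ≤
      |1 - q n| * (2 * K * (1 + 2 * K)) * ‖θ - θ'‖ := by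
    intro θ θ' hθ hθ'
    refine (norm_tiltMean_sub_le hn hKs h1.le ?_ hθ hθ').trans (le_of_eq (by ring))
    linarith
  have hclose : ∀ θ ∈ Metric.closedBall θ₀ R,
      ‖tiltMean (1 - q n) (fun i : Fin n => b (X i s)) θ - meanParam μ b θ₀‖ ≤ c * δ / 8 := by
    intro θ hθ
    -- Comparison with the parameter `0`, where the tilted mean is the plain sample mean. It may lie
    -- outside the ball around `θ₀`, which is why `D` bounds norms.
    have h5 := hlip θ 0 (hDR θ hθ) (by simpa using hD0)
    rw [tiltMean_zero, sub_zero] at h5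
    have h6 : |1 - q n| * (2 * K * (1 + 2 * K)) * ‖θ‖ ≤ c * δ / 16 := by
      refine le_trans ?_ h4.le
      rw [← mul_assoc |1 - q n| (2 * K * (1 + 2 * K))]
      refine mul_le_mul_of_nonneg_left (hDR θ hθ) ?_
      have : 0 ≤ K := le_trans (mul_nonneg (by positivity)
        (Finset.sum_nonneg fun i _ => expWeight_nonneg _ _)) hKs
      positivity
    rw [dist_eq_norm] at hg1
    have h7 := norm_sub_le_norm_sub_add_norm_sub
      (tiltMean (1 - q n) (fun i : Fin n => b (X i s)) θ)
      ((n : ℝ)⁻¹ • ∑ i : Fin n, b (X i s)) (meanParam μ b θ₀)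
    have h8 : ‖(n : ℝ)⁻¹ • ∑ i : Fin n, b (X i s) - meanParam μ b θ₀‖ < c * δ / 16 := hg1
    linarith
  obtain ⟨t, ht, htd⟩ := exists_isUniqueMLqE (x := fun i : Fin n => X i s) (q := q n) hb hrank.1 hΘ
    hc hball hmono hδ hδδ₀ ((Metric.closedBall_subset_ball hδρ).trans hρΘ) hR hn hclose
    fun θ hθ θ' hθ' => (hlip θ θ' (hDR θ hθ) (hDR θ' hθ')).trans (by gcongr)
  exact ⟨t, ht, htd.trans hδη⟩

end Consistency

end LqLikelihood

end

theorem theorem3p1 {Ω : Type*} [MeasurableSpace Ω] (μ : Measure Ω) [SigmaFinite μ]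
    {p : ℕ} (b : Ω → EuclideanSpace ℝ (Fin p)) (hb : Measurable b)
    (hrank : LqLikelihood.FullRank μ b)
    (Θ : Set (EuclideanSpace ℝ (Fin p))) (hΘ : Θ ⊆ LqLikelihood.natParamSpace μ b)
    (hcompact : IsCompact Θ)
    (θ₀ : EuclideanSpace ℝ (Fin p)) (hθ₀ : θ₀ ∈ interior Θ)
    (q : ℕ → ℝ) (hq_pos : ∀ n, 0 < q n) (hq : Tendsto q atTop (𝓝 1))
    {S : Type*} [MeasurableSpace S] (P : Measure S) [IsProbabilityMeasure P]
    (X : ℕ → S → Ω) (hindep : iIndepFun X P)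
    (hlaw : ∀ i, HasLaw (X i) (LqLikelihood.expFamily μ b θ₀) P) :
    -- with probability tending to 1 there is a unique solution, and it is the maximizer
    Tendsto (fun n : ℕ => P {s | ¬ ∃ t,
      LqLikelihood.IsUniqueMLqE μ b Θ (q n) (fun i : Fin n => X i s) t}) atTop (𝓝 0) ∧
    -- however it is extended to the remaining samples, this estimator is consistent
    ∀ T : ℕ → S → EuclideanSpace ℝ (Fin p),
      (∀ n s t, LqLikelihood.IsUniqueMLqE μ b Θ (q n) (fun i : Fin n => X i s) t →
        T n s = t) →
      TendstoInMeasure P T atTop (fun _ => θ₀) := by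
  -- If `μ` vanished, so would the law of `X 0`, a probability measure.
  have : NeZero μ := by
    refine ⟨fun h0 => ?_⟩
    have h := (hlaw 0).map_eq
    rw [LqLikelihood.expFamily, h0, withDensity_zero_left] at h
    exact (Measure.isProbabilityMeasure_map (hlaw 0).aemeasurable).ne_zero _ h
  have hnear := fun (η : ℝ) (hη : 0 < η) =>
    LqLikelihood.tendsto_measure_not_isUniqueMLqE_near hb hrank hΘ hcompact hθ₀ hq hindep hlaw hη
  refine ⟨?_, fun T hT => tendstoInMeasure_iff_dist.2 fun η hη => ?_⟩
  · refine tendsto_of_tendsto_of_tendsto_of_le_of_le tendsto_const_nhds (hnear 1 one_pos)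
      (fun n => zero_le) fun n => measure_mono fun s hs h => ?_
    obtain ⟨t, ht, -⟩ := h
    exact hs ⟨t, ht⟩
  · refine tendsto_of_tendsto_of_tendsto_of_le_of_le tendsto_const_nhds (hnear η hη)
      (fun n => zero_le) fun n => measure_mono fun s hs h => ?_
    obtain ⟨t, ht, htd⟩ := h
    have hs' : η ≤ dist (T n s) θ₀ := hs
    rw [hT n s t ht] at hs'
    exact absurd htd (not_lt.2 hs')
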